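/- For a finite alphabet $\Sigma$, equip the set $\Sigma^\omega$ of infinite words over $\Sigma$ with the product topology of the discrete topology on $\Sigma$. A finite state machine $(K,\Sigma,\delta,q_0)$ consists of a finite set $K$ of states, a finite input alphabet $\Sigma$, a transition function $\delta : K\times\Sigma\to 2^K$ and an initial state $q_0\in K$. A run on $\sigma=a_1a_2\cdots\in\Sigma^\omega$ is a sequence of states $r=q_1q_2\cdots$ with $q_1=q_0$ and $q_{i+1}\in\delta(q_i,a_i)$ for all $i\ge 1$; let $\mathrm{In}(r)$ be the set of states that occur infinitely often in $r$. A Büchi automaton $\mathcal A$ is such a machine together with a set $F\subseteq K$, and $L(\mathcal A)$ is the set of all $\sigma\in\Sigma^\omega$ that have a run $r$ with $\mathrm{In}(r)\cap F\neq\emptyset$. A Muller automaton $\mathcal A$ is such a machine together with a collection $\mathcal F\subseteq 2^K$, and $L(\mathcal A)$ is the set of all $\sigma\in\Sigma^\omega$ that have a run $r$ with $\mathrm{In}(r)\in\mathcal F$. A subset of $\Sigma^\omega$ is meager if it is a countable union of nowhere dense sets. Corollary. It is decidable, for a given Büchi or Muller automaton $\mathcal A$, whether $L(\mathcal A)$ is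 meager. That is, for each of the two kinds of automata there is an algorithm which, given any automaton $\mathcal A$ of that kind (presented by the numbers of its states and letters, its initial state, the list of its transitions, and the list of its final states, respectively of its designated state sets), decides whether $L(\mathcal A)$ is meager in $\Sigma^\omega$. -/

import Mathlib

open Filter

/-- A (nondeterministic, possibly incomplete) finite state machine with state set `K` and input
alphabet `S`. Finiteness of `K` and `S` is imposed where the machines are used. -/
structure FSM (K S : Type*) where
  /-- the transition function `K × S → 2^K` -/
  δ : K → S → Set K
  /-- the initial state -/
  q₀ : K

/-- `r` is an infinite run of `M` on the infinite word `σ`, starting in the initial state. -/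
def FSM.IsRun {K S : Type*} (M : FSM K S) (σ : ℕ → S) (r : ℕ → K) : Prop :=
  r 0 = M.q₀ ∧ ∀ i, r (i + 1) ∈ M.δ (r i) (σ i)

/-- The set of states that occur infinitely often in the sequence `r`. -/
def infStates {K : Type*} (r : ℕ → K) : Set K :=
  {q | ∃ᶠ i in atTop, r i = q}

/-- A Büchi automaton: a finite state machine with a set `F` of final states. -/
structure BuchiAutomaton (K S : Type*) extends FSM K S where
  /-- the final states -/
  F : Set K

/-- The ω-language accepted by a Büchi automaton. -/
def BuchiAutomaton.language {K S : Type*} (A : BuchiAutomaton K S) : Set (ℕ → S) :=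
  {σ | ∃ r, A.toFSM.IsRun σ r ∧ (infStates r ∩ A.F).Nonempty}

/-- A Muller automaton: a finite state machine with a collection `𝓕` of designated state sets. -/
structure MullerAutomaton (K S : Type*) extends FSM K S where
  /-- the designated sets of states -/
  𝓕 : Set (Set K)

/-- The ω-language accepted by a Muller automaton. -/
def MullerAutomaton.language {K S : Type*} (A : MullerAutomaton K S) : Set (ℕ → S) :=
  {σ | ∃ r, A.toFSM.IsRun σ r ∧ infStates r ∈ A.𝓕}

/-- Finite data that describe a finite state machine whose states are numbered
`0, …, numStates - 1` and whose letters are numbered `0, …, numLetters - 1`. -/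
structure FSMCode where
  numStates : ℕ
  numLetters : ℕ
  /-- the list of all transitions (source, letter, target) -/
  transitions : List (ℕ × ℕ × ℕ)
  initial : ℕ

/-- Codes of machines are tuples of numbers and lists. -/
def FSMCode.equivProd : FSMCode ≃ ℕ × ℕ × List (ℕ × ℕ × ℕ) × ℕ where
  toFun c := (c.numStates, c.numLetters, c.transitions, c.initial)
  invFun t := ⟨t.1, t.2.1, t.2.2.1, t.2.2.2⟩
  left_inv _ := rfl
  right_inv _ := rfl

instance FSMCode.primcodable : Primcodable FSMCode :=
  Primcodable.ofEquiv _ FSMCode.equivProd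

/-- `c` is a code of `M` under the numberings `eK` of the states and `eS` of the letters. -/
def FSMCode.EncodesVia {K S : Type*} (c : FSMCode) (M : FSM K S)
    (eK : K ≃ Fin c.numStates) (eS : S ≃ Fin c.numLetters) : Prop :=
  (eK M.q₀ : ℕ) = c.initial ∧
    ∀ p a q, q ∈ M.δ p a ↔ ((eK p : ℕ), (eS a : ℕ), (eK q : ℕ)) ∈ c.transitions

/-- A code of a Büchi automaton: the code of its machine and the list of its final states. -/
structure BuchiCode where
  machine : FSMCode
  final : List ℕ

/-- Codes of Büchi automata are pairs. -/
def BuchiCode.equivProd : BuchiCode ≃ FSMCode × List ℕ where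
  toFun c := (c.machine, c.final)
  invFun t := ⟨t.1, t.2⟩
  left_inv _ := rfl
  right_inv _ := rfl

instance BuchiCode.primcodable : Primcodable BuchiCode :=
  Primcodable.ofEquiv _ BuchiCode.equivProd

/-- `c` is a code of the Büchi automaton `A`, for some numbering of the states and letters. -/
def BuchiCode.Encodes {K S : Type*} (c : BuchiCode) (A : BuchiAutomaton K S) : Prop :=
  ∃ (eK : K ≃ Fin c.machine.numStates) (eS : S ≃ Fin c.machine.numLetters),
    c.machine.EncodesVia A.toFSM eK eS ∧ ∀ q, q ∈ A.F ↔ (eK q : ℕ) ∈ c.final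

/-- A code of a Muller automaton: the code of its machine and the list of its designated sets,
each given by a list of its members. -/
structure MullerCode where
  machine : FSMCode
  designated : List (List ℕ)

/-- Codes of Muller automata are pairs. -/
def MullerCode.equivProd : MullerCode ≃ FSMCode × List (List ℕ) where
  toFun c := (c.machine, c.designated)
  invFun t := ⟨t.1, t.2⟩
  left_inv _ := rfl
  right_inv _ := rfl

instance MullerCode.primcodable : Primcodable MullerCode :=
  Primcodable.ofEquiv _ MullerCode.equivProd

/-- `c` is a code of the Muller automaton `A`, for some numbering of the states and letters. -/
def MullerCode.Encodes {K S : Type*} (c : MullerCode) (A : MullerAutomaton K S) : Prop :=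
  ∃ (eK : K ≃ Fin c.machine.numStates) (eS : S ≃ Fin c.machine.numLetters),
    c.machine.EncodesVia A.toFSM eK eS ∧
      ∀ X : Set K, X ∈ A.𝓕 ↔ ∃ l ∈ c.designated, ∀ q, q ∈ X ↔ (eK q : ℕ) ∈ l

/-- Every finite state machine with finitely many states and letters has a code, for any
prescribed numberings. -/
theorem FSM.exists_code {K S : Type*} {n m : ℕ} (M : FSM K S) (eK : K ≃ Fin n) (eS : S ≃ Fin m) :
    ∃ T : List (ℕ × ℕ × ℕ), FSMCode.EncodesVia ⟨n, m, T, eK M.q₀⟩ M eK eS := by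
  classical
  refine ⟨((Finset.univ.filter fun t : Fin n × Fin m × Fin n =>
    eK.symm t.2.2 ∈ M.δ (eK.symm t.1) (eS.symm t.2.1)).toList.map
      fun t => ((t.1 : ℕ), (t.2.1 : ℕ), (t.2.2 : ℕ))), rfl, fun p a q => ?_⟩
  simp only [List.mem_map, Finset.mem_toList, Finset.mem_filter, Finset.mem_univ, true_and,
    Prod.mk.injEq]
  constructor
  · intro h
    exact ⟨(eK p, eS a, eK q), by simpa using h, rfl, rfl, rfl⟩
  · rintro ⟨⟨x, y, z⟩, h, hx, hy, hz⟩
    obtain rfl := Fin.ext hx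
    obtain rfl := Fin.ext hy
    obtain rfl := Fin.ext hz
    simpa using h

/-- The numbers of the members of a set of states can be listed. -/
theorem exists_list_states {K : Type*} {n : ℕ} (eK : K ≃ Fin n) (X : Set K) :
    ∃ l : List ℕ, ∀ q, q ∈ X ↔ (eK q : ℕ) ∈ l := by
  classical
  refine ⟨((Finset.univ.filter fun t : Fin n => eK.symm t ∈ X).toList.map fun t : Fin n => (t : ℕ)),
    fun q => ?_⟩
  simp only [List.mem_map, Finset.mem_toList, Finset.mem_filter, Finset.mem_univ, true_and]
  constructor
  · intro h
    exact ⟨eK q, by simpa using h, rfl⟩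
  · rintro ⟨x, h, hx⟩
    obtain rfl := Fin.ext hx
    simpa using h

/-- Every Büchi automaton has a code. -/
theorem BuchiAutomaton.exists_code {K S : Type*} [Finite K] [Finite S] (A : BuchiAutomaton K S) :
    ∃ c : BuchiCode, c.Encodes A := by
  obtain ⟨T, hT⟩ := A.toFSM.exists_code (Finite.equivFin K) (Finite.equivFin S)
  obtain ⟨l, hl⟩ := exists_list_states (Finite.equivFin K) A.F
  exact ⟨⟨⟨_, _, T, _⟩, l⟩, _, _, hT, hl⟩

/-- Every Muller automaton has a code. -/
theorem MullerAutomaton.exists_code {K S : Type*} [Finite K] [Finite S]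
    (A : MullerAutomaton K S) : ∃ c : MullerCode, c.Encodes A := by
  obtain ⟨T, hT⟩ := A.toFSM.exists_code (Finite.equivFin K) (Finite.equivFin S)
  choose g hg using exists_list_states (Finite.equivFin K)
  refine ⟨⟨⟨_, _, T, _⟩, (Set.toFinite A.𝓕).toFinset.toList.map g⟩, _, _, hT, fun X => ?_⟩
  simp only [List.mem_map, Finset.mem_toList, Set.Finite.mem_toFinset]
  constructor
  · intro h
    exact ⟨g X, ⟨X, h, rfl⟩, hg X⟩
  · rintro ⟨_, ⟨Y, hY, rfl⟩, h⟩
    have : X = Y := Set.ext fun q => (h q).trans (hg Y q).symm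
    exact this ▸ hY

/-!
A Büchi automaton with final states `F` is a Muller automaton whose designated sets are the sets
that meet `F`, so only acceptance by a collection `𝓕` of state sets has to be considered.

The profile of a finite word `u` records all triples `(p, X, q)` such that `u` labels a path from
`p` to `q` that visits exactly the states in `X`. There are finitely many profiles, and the profile
of `u ++ w` depends only on those of `u` and `w`. A word `u` is recurrent if after every
prolongation `u ++ w` the profile of `u` can be reached again. Recurrent words exist by finiteness
(`FSM.exists_recurrent`), and every word with a recurrent factor is recurrent.

The language is meagre if and only if no recurrent word labels a loop at a reachable state that
visits exactly the members of a set in `𝓕` (`FSM.isMeagre_iff`).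

* Suppose that such a loop exists, at `p`, labelled by `u`, and that `v` leads to `p`. A generic word
  that begins with `v ++ u` can be cut, after `v`, into infinitely many blocks that all have the
  profile of `u` (`FSM.residual_recurrent`). Each block labels a loop at `p` with the same visited
  set, and these loops make up an accepting run (`FSM.exists_isRun_of_loops`). So the language
  contains a set that is residual in a nonempty open set, and by Baire's theorem it is not meagre.
* A generic word contains a fixed recurrent word `z` infinitely often (`FSM.residual_occurs`). In an
  accepting run on it, a sufficiently long section between two occurrences of a recurring state
  visits exactly the recurring states and reads `z`, hence is a loop of the forbidden kind.

The existence of such a loop is decided by exhaustive search: by the pigeonhole principle every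
profile is the profile of a word whose length is at most the number of conceivable profiles
(`FSM.exists_short_profile_eq`), so all quantifiers over words can be bounded. The resulting
predicate on codes, `FSMCode.HasRecurrentLoop`, is primitive recursive.
-/

/-! ### Slices of infinite words -/

/-- The finite word `σ i, σ (i + 1), …, σ (j - 1)`. -/
def slice {S : Type*} (σ : ℕ → S) (i j : ℕ) : List S :=
  (List.Ico i j).map σ

section Slice

variable {S : Type*}

theorem slice_length (σ : ℕ → S) (i j : ℕ) : (slice σ i j).length = j - i := by
  simp [slice]

theorem slice_self (σ : ℕ → S) (i : ℕ) : slice σ i i = [] := by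
  simp [slice]

theorem slice_append (σ : ℕ → S) {i j k : ℕ} (hij : i ≤ j) (hjk : j ≤ k) :
    slice σ i j ++ slice σ j k = slice σ i k := by
  rw [slice, slice, ← List.map_append, List.Ico.append_consecutive hij hjk, slice]

theorem slice_succ (σ : ℕ → S) {i j : ℕ} (hij : i ≤ j) :
    slice σ i (j + 1) = slice σ i j ++ [σ j] := by
  rw [slice, List.Ico.succ_top hij, List.map_append]; rfl

theorem slice_congr {σ τ : ℕ → S} {n i j : ℕ} (h : ∀ k < n, τ k = σ k) (hj : j ≤ n) :
    slice τ i j = slice σ i j :=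
  List.map_congr_left fun k hk => h k ((List.Ico.mem.1 hk).2.trans_le hj)

/-- The letters of an infinite word from position `n` on can be changed so that a given finite
word stands at position `n`. -/
theorem exists_extend (σ : ℕ → S) (n : ℕ) (z : List S) :
    ∃ τ : ℕ → S, (∀ k < n, τ k = σ k) ∧ slice τ n (n + z.length) = z := by
  refine ⟨fun k => if k < n then σ k else z.getD (k - n) (σ 0), fun k hk => if_pos hk, ?_⟩
  apply List.ext_getElem
  · simp [slice_length]
  · intro k h1 h2
    simp [slice, List.Ico, h2]

variable [TopologicalSpace S] [DiscreteTopology S]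

theorem isOpen_of_prefix {s : Set (ℕ → S)}
    (h : ∀ σ ∈ s, ∃ n : ℕ, ∀ τ : ℕ → S, (∀ k < n, τ k = σ k) → τ ∈ s) : IsOpen s := by
  rw [isOpen_iff_forall_mem_open]
  intro σ hσ
  obtain ⟨n, hn⟩ := h σ hσ
  exact ⟨PiNat.cylinder σ n, fun τ hτ => hn τ (PiNat.mem_cylinder_iff.1 hτ),
    PiNat.isOpen_cylinder _ σ n, PiNat.self_mem_cylinder σ n⟩

theorem dense_of_prefix {s : Set (ℕ → S)}
    (h : ∀ (σ : ℕ → S) (n : ℕ), ∃ τ ∈ s, ∀ k < n, τ k = σ k) : Dense s := by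
  rw [(PiNat.isTopologicalBasis_cylinders fun _ : ℕ => S).dense_iff]
  rintro _ ⟨σ, n, rfl⟩ -
  obtain ⟨τ, hτ, hn⟩ := h σ n
  exact ⟨τ, PiNat.mem_cylinder_iff.2 hn, hτ⟩

end Slice

/-! ### Path profiles of finite words -/

namespace FSM

variable {K S : Type*}

/-- The effect of appending the letter `a` on a path profile: every path is prolonged by every
transition that is available at its end. -/
def profileStep (M : FSM K S) (T : Set (K × Set K × K)) (a : S) : Set (K × Set K × K) :=
  {t | ∃ s ∈ T, s.1 = t.1 ∧ t.2.2 ∈ M.δ s.2.2 a ∧ t.2.1 = insert t.2.2 s.2.1}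

/-- The path profile of a finite word `u`: the triples `(p, X, q)` such that some path from `p` to
`q` is labelled by `u` and visits exactly the states in `X`. The starting point of a path is not
counted as visited unless the path comes back to it, so that the path of length zero visits no
state. -/
def profile (M : FSM K S) (u : List S) : Set (K × Set K × K) :=
  u.foldl M.profileStep {t | t.2.1 = ∅ ∧ t.1 = t.2.2}

variable {M : FSM K S}

theorem mem_profile_nil {p q : K} {X : Set K} : (p, X, q) ∈ M.profile [] ↔ X = ∅ ∧ p = q :=
  Iff.rfl

theorem mem_profile_concat {u : List S} {a : S} {p q : K} {X : Set K} :
    (p, X, q) ∈ M.profile (u ++ [a]) ↔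
      ∃ Y s, (p, Y, s) ∈ M.profile u ∧ q ∈ M.δ s a ∧ X = insert q Y := by
  simp only [profile, List.foldl_append, List.foldl_cons, List.foldl_nil]
  constructor
  · rintro ⟨⟨p', Y, s⟩, h, rfl, h2, h3⟩
    exact ⟨Y, s, h, h2, h3⟩
  · rintro ⟨Y, s, h, h2, h3⟩
    exact ⟨(p, Y, s), h, rfl, h2, h3⟩

theorem mem_profile_append {u w : List S} {p q : K} {X : Set K} :
    (p, X, q) ∈ M.profile (u ++ w) ↔
      ∃ Y Z s, (p, Y, s) ∈ M.profile u ∧ (s, Z, q) ∈ M.profile w ∧ X = Y ∪ Z := by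
  induction w using List.reverseRecOn generalizing X q with
  | nil =>
    simp only [List.append_nil, mem_profile_nil]
    constructor
    · intro h
      exact ⟨X, ∅, q, h, ⟨rfl, rfl⟩, by simp⟩
    · rintro ⟨Y, Z, s, h, ⟨rfl, rfl⟩, rfl⟩
      simpa using h
  | append_singleton w a ih =>
    rw [← List.append_assoc, mem_profile_concat]
    constructor
    · rintro ⟨Y, s, h, hq, rfl⟩
      obtain ⟨Y', Z, s', h1, h2, rfl⟩ := ih.1 h
      exact ⟨Y', insert q Z, s', h1, mem_profile_concat.2 ⟨Z, s, h2, hq, rfl⟩,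
        (Set.union_insert ..).symm⟩
    · rintro ⟨Y, Z, s, h1, h2, rfl⟩
      obtain ⟨Z', s', h3, hq, rfl⟩ := mem_profile_concat.1 h2
      exact ⟨Y ∪ Z', s', ih.2 ⟨Y, Z', s, h1, h3, rfl⟩, hq, Set.union_insert ..⟩

theorem profile_append_congr {u u' w w' : List S} (hu : M.profile u = M.profile u')
    (hw : M.profile w = M.profile w') : M.profile (u ++ w) = M.profile (u' ++ w') := by
  ext ⟨p, X, q⟩
  rw [mem_profile_append, mem_profile_append, hu, hw]

/-- A run restricted to an interval is a path. -/
theorem mem_profile_slice {σ : ℕ → S} {r : ℕ → K} (h : ∀ k, r (k + 1) ∈ M.δ (r k) (σ k))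
    {i j : ℕ} (hij : i ≤ j) :
    (r i, r '' Set.Ioc i j, r j) ∈ M.profile (slice σ i j) := by
  induction j, hij using Nat.le_induction with
  | base => simp [slice_self, mem_profile_nil]
  | succ j hij ih =>
    rw [slice_succ σ hij, mem_profile_concat]
    refine ⟨_, _, ih, h j, ?_⟩
    rw [← Set.image_insert_eq]
    congr 1
    ext k
    simp only [Set.mem_Ioc, Set.mem_insert_iff]
    omega

/-- A path labelled by a slice of `σ`, indexed by the positions of that slice. -/
theorem exists_path_of_mem_profile {σ : ℕ → S} {i j : ℕ} (hij : i ≤ j) {p q : K} {X : Set K}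
    (h : (p, X, q) ∈ M.profile (slice σ i j)) :
    ∃ r : ℕ → K, r i = p ∧ r j = q ∧ (∀ k, i ≤ k → k < j → r (k + 1) ∈ M.δ (r k) (σ k)) ∧
      r '' Set.Ioc i j = X := by
  induction j, hij using Nat.le_induction generalizing X q with
  | base =>
    rw [slice_self, mem_profile_nil] at h
    obtain ⟨rfl, rfl⟩ := h
    exact ⟨fun _ => p, rfl, rfl, fun k h1 h2 => absurd h1 (not_le.2 h2), by simp⟩
  | succ j hij ih =>
    rw [slice_succ σ hij, mem_profile_concat] at h
    obtain ⟨Y, s, h, hq, rfl⟩ := h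
    obtain ⟨r, hi, hj, hr, rfl⟩ := ih h
    have hne : ∀ k, k ≤ j → Function.update r (j + 1) q k = r k := fun k hk =>
      Function.update_of_ne (by omega) _ _
    refine ⟨Function.update r (j + 1) q, ?_, by simp, fun k h1 h2 => ?_, ?_⟩
    · rw [hne i hij, hi]
    · rcases Nat.lt_succ_iff_lt_or_eq.1 h2 with h2 | rfl
      · rw [hne k h2.le, hne (k + 1) h2]
        exact hr k h1 h2
      · rw [hne k le_rfl, Function.update_self, hj]
        exact hq
    · have : Set.Ioc i (j + 1) = insert (j + 1) (Set.Ioc i j) := by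
        ext k
        simp only [Set.mem_Ioc, Set.mem_insert_iff]
        omega
      rw [this, Set.image_insert_eq, Function.update_self]
      congr 1
      exact Set.image_congr fun k hk => hne k hk.2

/-- A path from the initial state to `p`, followed by infinitely many loops at `p` that each visit
exactly the states in `X`, forms a run in which exactly the states in `X` recur. -/
theorem exists_isRun_of_loops {σ : ℕ → S} {n : ℕ → ℕ} (hn : StrictMono n) {p : K} {X Y : Set K}
    (h0 : (M.q₀, Y, p) ∈ M.profile (slice σ 0 (n 0)))
    (hloop : ∀ k, (p, X, p) ∈ M.profile (slice σ (n k) (n (k + 1)))) :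
    ∃ r, M.IsRun σ r ∧ infStates r = X := by
  classical
  obtain ⟨s, hs0, hsn, hs, -⟩ := exists_path_of_mem_profile (Nat.zero_le _) h0
  choose t ht ht' htδ htX using fun k =>
    exists_path_of_mem_profile (hn.monotone (Nat.le_succ k)) (hloop k)
  have hex : ∀ i, ∃ k, i ≤ n k := fun i => ⟨i, hn.id_le i⟩
  -- At position `i` the run follows the path of the block that ends at the first `n k ≥ i`.
  let r : ℕ → K := fun i =>
    match Nat.find (hex i) with
    | 0 => s i
    | k + 1 => t k i
  have hr0 : ∀ i ≤ n 0, r i = s i := by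
    intro i hi
    have : Nat.find (hex i) = 0 := (Nat.find_eq_zero _).2 hi
    simp only [r, this]
  have hr1 : ∀ k i, n k < i → i ≤ n (k + 1) → r i = t k i := by
    intro k i h1 h2
    have : Nat.find (hex i) = k + 1 :=
      (Nat.find_eq_iff _).2 ⟨h2, fun l hl => by
        have := hn.monotone (Nat.lt_succ_iff.1 hl)
        omega⟩
    simp only [r, this]
  have hrp : ∀ k, r (n k) = p := by
    intro k
    cases k with
    | zero => rw [hr0 _ le_rfl, hsn]
    | succ k => rw [hr1 k _ (hn (Nat.lt_succ_self k)) le_rfl, ht']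
  have hr2 : ∀ k i, n k ≤ i → i ≤ n (k + 1) → r i = t k i := by
    intro k i h1 h2
    rcases h1.eq_or_lt with rfl | h1
    · rw [hrp, ht]
    · exact hr1 k i h1 h2
  have hblock : ∀ i, n 0 < i → ∃ k, n k < i ∧ i ≤ n (k + 1) := by
    intro i hi
    obtain ⟨k, hk⟩ : ∃ k, Nat.find (hex i) = k + 1 :=
      Nat.exists_eq_succ_of_ne_zero fun h => absurd ((Nat.find_eq_zero _).1 h) (not_le.2 hi)
    refine ⟨k, ?_, ?_⟩
    · exact not_le.1 (Nat.find_min (hex i) (by omega))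
    · rw [← hk]
      exact Nat.find_spec (hex i)
  refine ⟨r, ⟨by rw [hr0 0 (Nat.zero_le _), hs0], fun i => ?_⟩, ?_⟩
  · rcases lt_or_ge i (n 0) with hi | hi
    · rw [hr0 i hi.le, hr0 (i + 1) hi]
      exact hs i (Nat.zero_le _) hi
    · obtain ⟨k, h1, h2⟩ := hblock (i + 1) (Nat.lt_succ_of_le hi)
      rw [hr2 k i (Nat.lt_succ_iff.1 h1) (by omega), hr2 k (i + 1) h1.le h2]
      exact htδ k i (Nat.lt_succ_iff.1 h1) h2
  · ext q
    rw [infStates, Set.mem_ofPred_eq, frequently_atTop]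
    constructor
    · intro h
      obtain ⟨i, hi, rfl⟩ := h (n 0 + 1)
      obtain ⟨k, h1, h2⟩ := hblock i hi
      rw [← htX k, hr1 k i h1 h2]
      exact ⟨i, ⟨h1, h2⟩, rfl⟩
    · intro hq N
      rw [← htX N] at hq
      obtain ⟨i, ⟨h1, h2⟩, rfl⟩ := hq
      exact ⟨i, (hn.id_le N).trans h1.le, hr1 N i h1 h2⟩

/-! ### Recurrent words -/

/-- A word is recurrent if every prolongation of it can be prolonged further so as to have the
profile of the original word again. -/
def Recurrent (M : FSM K S) (u : List S) : Prop :=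
  ∀ w, ∃ y, M.profile (u ++ w ++ y) = M.profile u

theorem Recurrent.append_right {u : List S} (hu : M.Recurrent u) (y : List S) :
    M.Recurrent (u ++ y) := by
  intro w
  obtain ⟨y', hy'⟩ := hu (y ++ w)
  refine ⟨y' ++ y, ?_⟩
  simpa using profile_append_congr hy' (rfl : M.profile y = _)

theorem Recurrent.append_left {u : List S} (hu : M.Recurrent u) (x : List S) :
    M.Recurrent (x ++ u) := by
  intro w
  obtain ⟨y, hy⟩ := hu w
  refine ⟨y, ?_⟩
  simpa using profile_append_congr (rfl : M.profile x = _) hy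

theorem exists_recurrent [Finite K] (M : FSM K S) : ∃ z, M.Recurrent z := by
  -- A word whose prolongations realize as few profiles as possible is recurrent.
  let R : List S → Set (Set (K × Set K × K)) := fun u => Set.range fun w => M.profile (u ++ w)
  obtain ⟨u, hu⟩ : ∃ u, ∀ u', (R u).ncard ≤ (R u').ncard :=
    ⟨Function.argmin fun u => (R u).ncard, fun u' => Function.argmin_le (fun u => (R u).ncard) u'⟩
  refine ⟨u, fun w => ?_⟩
  have hsub : R (u ++ w) ⊆ R u := by
    rintro _ ⟨y, rfl⟩
    exact ⟨w ++ y, by simp⟩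
  have heq : R (u ++ w) = R u := Set.eq_of_subset_of_ncard_le hsub (hu _) (Set.toFinite _)
  have : M.profile u ∈ R (u ++ w) := heq ▸ ⟨[], by simp⟩
  exact this

/-! ### Meagre languages -/

/-- There is a loop at a reachable state that is labelled by a recurrent word and visits exactly
the members of one of the sets in `𝓕`. The condition `p ∈ X` excludes the loop of length zero. -/
def HasRecurrentLoop (M : FSM K S) (𝓕 : Set (Set K)) : Prop :=
  ∃ u, M.Recurrent u ∧ ∃ p X, (p, X, p) ∈ M.profile u ∧ p ∈ X ∧ X ∈ 𝓕 ∧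
    ∃ v Y, (M.q₀, Y, p) ∈ M.profile v

variable [TopologicalSpace S] [DiscreteTopology S]

/-- If an occurrence of the recurrent word `u` begins at position `i` of a generic word, then at
some later position another occurrence begins, and the slice in between has the profile of
`u`. -/
theorem residual_recurrent {u : List S} (hu : M.Recurrent u) (hne : u ≠ []) (i : ℕ) :
    {σ : ℕ → S | slice σ i (i + u.length) = u → ∃ j > i,
      M.profile (slice σ i j) = M.profile u ∧ slice σ j (j + u.length) = u}
        ∈ residual (ℕ → S) := by
  have hpos := List.length_pos_iff.2 hne
  refine residual_of_dense_open (isOpen_of_prefix fun σ hσ => ?_) (dense_of_prefix fun σ n => ?_)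
  · by_cases h : slice σ i (i + u.length) = u
    · obtain ⟨j, hj, h1, h2⟩ := hσ h
      refine ⟨j + u.length, fun τ hτ _ => ⟨j, hj, ?_, ?_⟩⟩
      · rwa [slice_congr hτ (by omega)]
      · rwa [slice_congr hτ le_rfl]
    · exact ⟨i + u.length, fun τ hτ h' => absurd (slice_congr hτ le_rfl ▸ h') h⟩
  · by_cases h : slice σ i (i + u.length) = u
    · obtain ⟨N, hN, hnN⟩ : ∃ N, i + u.length ≤ N ∧ n ≤ N :=
        ⟨max _ _, le_max_left .., le_max_right ..⟩
      -- By recurrence, the prefix of length `N` can be prolonged so that the profile of `u`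
      -- comes back.
      obtain ⟨y, hy⟩ := hu (slice σ (i + u.length) N)
      obtain ⟨τ, h1, h2⟩ := exists_extend σ N (y ++ u)
      rw [List.length_append, ← Nat.add_assoc,
        ← slice_append τ (Nat.le_add_right N y.length) (Nat.le_add_right _ u.length)] at h2
      obtain ⟨h3, h4⟩ := List.append_inj h2 (by simp [slice_length])
      refine ⟨τ, fun _ => ⟨N + y.length, by omega, ?_, h4⟩, fun k hk => h1 k (by omega)⟩
      rw [← slice_append τ (by omega : i ≤ N) (Nat.le_add_right N y.length), h3,
        slice_congr h1 le_rfl, ← slice_append σ (Nat.le_add_right i u.length) hN, h]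
      exact hy
    · exact ⟨σ, fun h' => absurd h' h, fun _ _ => rfl⟩

/-- In a generic word, a given finite word occurs at arbitrarily late positions. -/
theorem residual_occurs (z : List S) (N : ℕ) :
    {σ : ℕ → S | ∃ i ≥ N, slice σ i (i + z.length) = z} ∈ residual (ℕ → S) := by
  refine residual_of_dense_open (isOpen_of_prefix fun σ hσ => ?_) (dense_of_prefix fun σ n => ?_)
  · obtain ⟨i, hi, h⟩ := hσ
    exact ⟨i + z.length, fun τ hτ => ⟨i, hi, by rwa [slice_congr hτ le_rfl]⟩⟩
  · obtain ⟨τ, h1, h2⟩ := exists_extend σ (max N n) z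
    exact ⟨τ, ⟨_, le_max_left .., h2⟩, fun k hk => h1 k (hk.trans_le (le_max_right ..))⟩

/-- If `v` leads from the initial state to `p` and the recurrent word `u` labels a loop at `p`, then
a generic word that begins with `v ++ u` splits, after `v`, into blocks with the profile of `u`. Each
block labels a loop at `p` that visits the same states, so the word is accepted. -/
theorem not_isMeagre_of_hasRecurrentLoop [Finite S] {𝓕 : Set (Set K)}
    (h : M.HasRecurrentLoop 𝓕) :
    ¬ IsMeagre {σ | ∃ r, M.IsRun σ r ∧ infStates r ∈ 𝓕} := by
  obtain ⟨u, hu, p, X, hX, hpX, hXF, v, Y, hY⟩ := h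
  have hne : u ≠ [] := by
    rintro rfl
    rw [(mem_profile_nil.1 hX).1] at hpX
    exact hpX
  -- Generic words that begin with `v ++ u` are accepted.
  let U : Set (ℕ → S) := {σ | slice σ 0 (v ++ u).length = v ++ u}
  have hU : IsOpen U := isOpen_of_prefix fun σ hσ =>
    ⟨_, fun τ hτ => (slice_congr hτ le_rfl).trans hσ⟩
  have hUne : U.Nonempty := by
    obtain ⟨τ, -, hτ⟩ := exists_extend (fun _ => u.head hne) 0 (v ++ u)
    exact ⟨τ, by simpa [U] using hτ⟩
  intro hmeagre
  refine not_isMeagre_of_isOpen hU hUne ?_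
  have hres := eventually_countable_forall.2 fun i => residual_recurrent hu hne i
  refine mem_of_superset (inter_mem hmeagre hres) ?_
  rintro σ ⟨hσL, hσ⟩ hσU
  apply hσL
  simp only [U, Set.mem_ofPred_eq, List.length_append] at hσU
  rw [← slice_append σ (Nat.zero_le v.length) (Nat.le_add_right _ _)] at hσU
  obtain ⟨hv, hvu⟩ := List.append_inj hσU (by simp [slice_length])
  choose! g hg1 hg2 hg3 using hσ
  let n : ℕ → ℕ := fun k => g^[k] v.length
  have hn1 : ∀ k, n (k + 1) = g (n k) := fun k => Function.iterate_succ_apply' g k _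
  have hn : ∀ k, slice σ (n k) (n k + u.length) = u := by
    intro k
    induction k with
    | zero => exact hvu
    | succ k ih => rw [hn1]; exact hg3 _ ih
  obtain ⟨r, hr, hrX⟩ := exists_isRun_of_loops (M := M) (σ := σ) (n := n) (p := p) (X := X) (Y := Y)
    (strictMono_nat_of_lt_succ fun k => by rw [hn1]; exact hg1 _ (hn k))
    (by
      change _ ∈ M.profile (slice σ 0 v.length)
      rwa [hv])
    (fun k => by rw [hn1, hg2 _ (hn k)]; exact hX)
  exact ⟨r, hr, hrX ▸ hXF⟩

/-- A generic word contains a recurrent word `z` again and again. If a run on it is accepting, then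
a section of the run that returns to its starting state, visits exactly the recurring states and
reads `z` on the way is a loop labelled by a recurrent word. -/
theorem isMeagre_of_not_hasRecurrentLoop [Finite K] {𝓕 : Set (Set K)}
    (h : ¬ M.HasRecurrentLoop 𝓕) :
    IsMeagre {σ | ∃ r, M.IsRun σ r ∧ infStates r ∈ 𝓕} := by
  obtain ⟨z, hz⟩ := M.exists_recurrent
  refine mem_of_superset (eventually_countable_forall.2 fun N => residual_occurs z N) ?_
  rintro σ hσ ⟨r, ⟨hr0, hr⟩, hX⟩
  apply h
  set X := infStates r with hXdef
  obtain ⟨N, hN⟩ : ∃ N, ∀ i ≥ N, r i ∈ X := by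
    have : ∀ q : K, ∀ᶠ i in atTop, q ∉ X → r i ≠ q := fun q => by
      by_cases hq : q ∈ X
      · exact Eventually.of_forall fun i h => absurd hq h
      · exact (not_frequently.1 hq).mono fun i hi _ => hi
    obtain ⟨N, hN⟩ := eventually_atTop.1 (eventually_all.2 this)
    exact ⟨N, fun i hi => by_contra fun hc => hN i hi _ hc rfl⟩
  have hfreq : ∀ q ∈ X, ∀ m, ∃ i ≥ m, r i = q := fun q hq => frequently_atTop.1 hq
  -- Between positions `N` and `j` all members of `X` are visited and `z` occurs.
  choose! f hf1 hf2 using fun q hq => hfreq q hq (N + 1)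
  obtain ⟨B, hB⟩ := (Set.finite_range f).bddAbove
  obtain ⟨i, hi, hiz⟩ := hσ N
  obtain ⟨j, hj, hrj⟩ := hfreq (r N) (hN N le_rfl) (max (N + 1) (max B (i + z.length)))
  simp only [ge_iff_le, max_le_iff] at hj
  have himage : r '' Set.Ioc N j = X := by
    apply Set.Subset.antisymm
    · rintro _ ⟨k, hk, rfl⟩
      exact hN k hk.1.le
    · intro q hq
      exact ⟨f q, ⟨hf1 q hq, (hB ⟨q, rfl⟩).trans hj.2.1⟩, hf2 q hq⟩
  refine ⟨slice σ N j, ?_, r N, X, ?_, hN N le_rfl, hX, slice σ 0 N, r '' Set.Ioc 0 N, ?_⟩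
  · rw [← slice_append σ (hi.trans (Nat.le_add_right i z.length)) hj.2.2,
      ← slice_append σ hi (Nat.le_add_right i z.length), hiz]
    exact (hz.append_left _).append_right _
  · have := mem_profile_slice hr (by omega : N ≤ j)
    rwa [himage, hrj] at this
  · have := mem_profile_slice hr (Nat.zero_le N)
    rwa [hr0] at this

theorem isMeagre_iff [Finite K] [Finite S] (M : FSM K S) (𝓕 : Set (Set K)) :
    IsMeagre {σ | ∃ r, M.IsRun σ r ∧ infStates r ∈ 𝓕} ↔ ¬ M.HasRecurrentLoop 𝓕 :=
  ⟨fun h h' => not_isMeagre_of_hasRecurrentLoop h' h, isMeagre_of_not_hasRecurrentLoop⟩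

end FSM

/-! ### Short words realize all profiles -/

namespace FSM

variable {K S : Type*} {M : FSM K S}

/-- Every profile is realized by a word whose length is at most the number of all conceivable
profiles: in a longer word two prefixes have the same profile, and what lies between can be cut. -/
theorem exists_short_profile_eq [Finite K] (M : FSM K S) (w : List S) :
    ∃ w', w'.length ≤ Nat.card (Set (K × Set K × K)) ∧ M.profile w' = M.profile w := by
  induction hl : w.length using Nat.strong_induction_on generalizing w with
  | _ l ih =>
    subst hl
    by_cases hw : w.length ≤ Nat.card (Set (K × Set K × K))
    · exact ⟨w, hw, rfl⟩
    obtain ⟨i, j, hij, heq⟩ : ∃ i j : Fin w.length, i < j ∧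
        M.profile (w.take i) = M.profile (w.take j) := by
      obtain ⟨i, j, hne, heq⟩ := Function.not_injective_iff.1 fun
        hinj : Function.Injective fun i : Fin w.length => M.profile (w.take i) =>
          hw (by simpa using Nat.card_le_card_of_injective _ hinj)
      rcases lt_or_gt_of_ne heq with h | h
      · exact ⟨i, j, h, hne⟩
      · exact ⟨j, i, h, hne.symm⟩
    have hcut : M.profile (w.take i ++ w.drop j) = M.profile w := by
      conv_rhs => rw [← List.take_append_drop j w]
      exact profile_append_congr heq rfl
    have hlt : (w.take i ++ w.drop j).length < w.length := by
      have := j.isLt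
      have : (i : ℕ) < j := hij
      simp only [List.length_append, List.length_take, List.length_drop]
      omega
    obtain ⟨w', h1, h2⟩ := ih _ hlt _ rfl
    exact ⟨w', h1, h2.trans hcut⟩

end FSM

/-! ### The decision procedure -/

/-- All words of length at most `N` over the letters `0, …, m - 1`. -/
def wordsUpTo (m N : ℕ) : List (List ℕ) :=
  Nat.rec [[]] (fun _ W => [] :: W.flatMap fun w => (List.range m).map fun a => a :: w) N

theorem mem_wordsUpTo {m N : ℕ} {w : List ℕ} :
    w ∈ wordsUpTo m N ↔ w.length ≤ N ∧ ∀ a ∈ w, a < m := by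
  induction N generalizing w with
  | zero =>
    change w ∈ [[]] ↔ _
    simp only [List.mem_singleton, Nat.le_zero, List.length_eq_zero_iff]
    constructor
    · rintro rfl
      simp
    · exact And.left
  | succ N ih =>
    change w ∈ [] :: (wordsUpTo m N).flatMap _ ↔ _
    cases w with
    | nil => simp
    | cons a w =>
      simp only [List.mem_cons, reduceCtorEq, false_or, List.mem_flatMap, List.mem_map,
        List.mem_range, List.cons.injEq, List.length_cons, Nat.add_le_add_iff_right,
        forall_eq_or_imp, ih]
      constructor
      · rintro ⟨w', ⟨h1, h2⟩, a', ha, rfl, rfl⟩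
        exact ⟨h1, ha, h2⟩
      · rintro ⟨h1, ha, h2⟩
        exact ⟨w, ⟨h1, h2⟩, a, ha, rfl, rfl⟩

/-- The lists `l` and `l'` contain the same numbers below `n`. -/
def SameBelow (n : ℕ) (l l' : List ℕ) : Prop :=
  ∀ x < n, x ∈ l ↔ x ∈ l'

namespace FSMCode

/-- The number of all conceivable path profiles of a machine with the given number of states. -/
def numProfiles (c : FSMCode) : ℕ :=
  2 ^ (c.numStates * (2 ^ c.numStates * c.numStates))

/-- Sufficiently many words to realize all path profiles. -/
def words (c : FSMCode) : List (List ℕ) :=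
  wordsUpTo c.numLetters c.numProfiles

/-- The counterpart of `FSM.profileStep` for lists of triples. -/
def profileStep (c : FSMCode) (T : List (ℕ × List ℕ × ℕ)) (a : ℕ) : List (ℕ × List ℕ × ℕ) :=
  T.flatMap fun s => c.transitions.flatMap fun e =>
    if e.1 = s.2.2 ∧ e.2.1 = a ∧ e.2.2 < c.numStates then [(s.1, e.2.2 :: s.2.1, e.2.2)] else []

/-- The path profile of a word, as a list of triples. Sets of states are represented by lists of
their members, possibly with repetitions. -/
def profile (c : FSMCode) (u : List ℕ) : List (ℕ × List ℕ × ℕ) :=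
  u.foldl c.profileStep ((List.range c.numStates).map fun p => (p, [], p))

/-- The triple `t` occurs in the list `T`, up to the representation of its set of states. -/
def HasTriple (c : FSMCode) (t : ℕ × List ℕ × ℕ) (T : List (ℕ × List ℕ × ℕ)) : Prop :=
  ∃ t' ∈ T, t'.1 = t.1 ∧ t'.2.2 = t.2.2 ∧ SameBelow c.numStates t'.2.1 t.2.1

/-- Two lists of triples represent the same profile. -/
def SameProfile (c : FSMCode) (T T' : List (ℕ × List ℕ × ℕ)) : Prop :=
  (∀ t ∈ T, c.HasTriple t T') ∧ ∀ t ∈ T', c.HasTriple t T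

/-- The counterpart of `FSM.Recurrent`, with bounded quantifiers. -/
def Recurrent (c : FSMCode) (u : List ℕ) : Prop :=
  ∀ w ∈ c.words, ∃ y ∈ c.words, c.SameProfile (c.profile (u ++ w ++ y)) (c.profile u)

/-- Some path leads from the initial state to `p`. -/
def Reachable (c : FSMCode) (p : ℕ) : Prop :=
  ∃ v ∈ c.words, ∃ s ∈ c.profile v, s.1 = c.initial ∧ s.2.2 = p

/-- The counterpart of `FSM.HasRecurrentLoop`, with bounded quantifiers. The predicate `acc` tells
which sets of states are accepting. -/
def HasRecurrentLoop (c : FSMCode) (acc : List ℕ → Prop) : Prop :=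
  ∃ u ∈ c.words, c.Recurrent u ∧
    ∃ t ∈ c.profile u, t.2.2 = t.1 ∧ t.1 ∈ t.2.1 ∧ acc t.2.1 ∧ c.Reachable t.1

/-! ### Correctness of the decision procedure -/

section Correctness

variable {K S : Type*} {M : FSM K S} {c : FSMCode} {eK : K ≃ Fin c.numStates}
  {eS : S ≃ Fin c.numLetters}

/-- The numbers of the letters of a word. -/
def letterNumbers {m : ℕ} (eS : S ≃ Fin m) (u : List S) : List ℕ :=
  u.map fun a => (eS a : ℕ)

theorem letterNumbers_append {m : ℕ} (eS : S ≃ Fin m) (u w : List S) :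
    letterNumbers eS (u ++ w) = letterNumbers eS u ++ letterNumbers eS w :=
  List.map_append

theorem profile_concat (c : FSMCode) (u : List ℕ) (a : ℕ) :
    c.profile (u ++ [a]) = c.profileStep (c.profile u) a := by
  simp [profile]

theorem mem_profileStep {T : List (ℕ × List ℕ × ℕ)} {a : ℕ} {t : ℕ × List ℕ × ℕ} :
    t ∈ c.profileStep T a ↔ ∃ s ∈ T, ∃ q, (s.2.2, a, q) ∈ c.transitions ∧ q < c.numStates ∧
      t = (s.1, q :: s.2.1, q) := by
  simp only [profileStep, List.mem_flatMap]
  constructor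
  · rintro ⟨s, hs, ⟨p, a', q⟩, he, ht⟩
    split_ifs at ht with h
    · obtain ⟨rfl, rfl, hq⟩ := h
      exact ⟨s, hs, q, he, hq, by simpa using ht⟩
    · simp at ht
  · rintro ⟨s, hs, q, he, hq, rfl⟩
    exact ⟨s, hs, _, he, by simp [hq]⟩

/-- The triples in the list `c.profile` come from triples in the path profile of the machine. -/
theorem mem_fsmProfile_of_mem_profile (hc : c.EncodesVia M eK eS) (u : List S)
    {t : ℕ × List ℕ × ℕ} (ht : t ∈ c.profile (letterNumbers eS u)) :
    ∃ p q, t.1 = eK p ∧ t.2.2 = eK q ∧ (p, {x | (eK x : ℕ) ∈ t.2.1}, q) ∈ M.profile u := by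
  induction u using List.reverseRecOn generalizing t with
  | nil =>
    simp only [letterNumbers, profile, List.map_nil, List.foldl_nil, List.mem_map,
      List.mem_range] at ht
    obtain ⟨p, hp, rfl⟩ := ht
    refine ⟨eK.symm ⟨p, hp⟩, eK.symm ⟨p, hp⟩, by simp, by simp, FSM.mem_profile_nil.2 ⟨?_, rfl⟩⟩
    simp
  | append_singleton u a ih =>
    rw [letterNumbers_append] at ht
    change t ∈ c.profile (_ ++ [(eS a : ℕ)]) at ht
    rw [profile_concat, mem_profileStep] at ht
    obtain ⟨s, hs, q, he, hq, rfl⟩ := ht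
    obtain ⟨p, s', hp, hs', h⟩ := ih hs
    obtain ⟨q, rfl⟩ : ∃ q', (eK q' : ℕ) = q := ⟨eK.symm ⟨q, hq⟩, by simp⟩
    refine ⟨p, q, hp, rfl, FSM.mem_profile_concat.2 ⟨_, s', h, (hc.2 _ _ _).2 (hs' ▸ he), ?_⟩⟩
    ext x
    simp [Fin.val_inj]

/-- Every triple in the path profile of the machine is represented in the list `c.profile`. -/
theorem exists_mem_profile_of_mem_fsmProfile (hc : c.EncodesVia M eK eS) (u : List S) {p q : K}
    {X : Set K} (h : (p, X, q) ∈ M.profile u) :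
    ∃ l, ((eK p : ℕ), l, (eK q : ℕ)) ∈ c.profile (letterNumbers eS u) ∧
      {x | (eK x : ℕ) ∈ l} = X := by
  induction u using List.reverseRecOn generalizing q X with
  | nil =>
    obtain ⟨rfl, rfl⟩ := FSM.mem_profile_nil.1 h
    exact ⟨[], by simp [letterNumbers, profile], by simp⟩
  | append_singleton u a ih =>
    obtain ⟨Y, s, h', hq, rfl⟩ := FSM.mem_profile_concat.1 h
    obtain ⟨l, hl, rfl⟩ := ih h'
    refine ⟨eK q :: l, ?_, ?_⟩
    · rw [letterNumbers_append]
      change _ ∈ c.profile (_ ++ [(eS a : ℕ)])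
      rw [profile_concat, mem_profileStep]
      exact ⟨_, hl, _, (hc.2 _ _ _).1 hq, (eK q).isLt, rfl⟩
    · ext x
      simp [Fin.val_inj]

theorem sameBelow_iff (eK : K ≃ Fin c.numStates) {l l' : List ℕ} :
    SameBelow c.numStates l l' ↔ {x | (eK x : ℕ) ∈ l} = {x | (eK x : ℕ) ∈ l'} := by
  rw [Set.ext_iff]
  constructor
  · intro h x
    exact h _ (eK x).isLt
  · intro h x hx
    simpa using h (eK.symm ⟨x, hx⟩)

theorem profile_subset_iff (hc : c.EncodesVia M eK eS) (u w : List S) :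
    (∀ t ∈ c.profile (letterNumbers eS u), c.HasTriple t (c.profile (letterNumbers eS w))) ↔
      M.profile u ⊆ M.profile w := by
  constructor
  · rintro h ⟨p, X, q⟩ hX
    obtain ⟨l, hl, rfl⟩ := exists_mem_profile_of_mem_fsmProfile hc u hX
    obtain ⟨t, ht, h1, h2, h3⟩ := h _ hl
    obtain ⟨p', q', h4, h5, h6⟩ := mem_fsmProfile_of_mem_profile hc w ht
    obtain rfl : p' = p := eK.injective (Fin.ext (h4.symm.trans h1))
    obtain rfl : q' = q := eK.injective (Fin.ext (h5.symm.trans h2))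
    rwa [(sameBelow_iff eK).1 h3] at h6
  · intro h t ht
    obtain ⟨p, q, h1, h2, h3⟩ := mem_fsmProfile_of_mem_profile hc u ht
    obtain ⟨l, hl, hX⟩ := exists_mem_profile_of_mem_fsmProfile hc w (h h3)
    exact ⟨_, hl, h1.symm, h2.symm, (sameBelow_iff eK).2 hX⟩

theorem sameProfile_iff (hc : c.EncodesVia M eK eS) (u w : List S) :
    c.SameProfile (c.profile (letterNumbers eS u)) (c.profile (letterNumbers eS w)) ↔
      M.profile u = M.profile w := by
  rw [SameProfile, profile_subset_iff hc, profile_subset_iff hc, Set.Subset.antisymm_iff]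

theorem card_profiles (eK : K ≃ Fin c.numStates) :
    Nat.card (Set (K × Set K × K)) = c.numProfiles := by
  have := Finite.of_equiv _ eK.symm
  have := Fintype.ofFinite K
  have hK : Fintype.card K = c.numStates := by simpa using Fintype.card_congr eK
  classical
  rw [Nat.card_eq_fintype_card, Fintype.card_set, Fintype.card_prod, Fintype.card_prod,
    Fintype.card_set, hK, numProfiles]

/-- Every word has the same profile as one of the words in `c.words`. -/
theorem exists_mem_words (eK : K ≃ Fin c.numStates) (eS : S ≃ Fin c.numLetters) (M : FSM K S)
    (w : List S) : ∃ w', letterNumbers eS w' ∈ c.words ∧ M.profile w' = M.profile w := by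
  have := Finite.of_equiv _ eK.symm
  obtain ⟨w', h1, h2⟩ := M.exists_short_profile_eq w
  refine ⟨w', mem_wordsUpTo.2 ⟨?_, ?_⟩, h2⟩
  · rwa [letterNumbers, List.length_map, ← card_profiles eK]
  · simp [letterNumbers]

theorem exists_letterNumbers_eq (eS : S ≃ Fin c.numLetters) {w : List ℕ} (hw : w ∈ c.words) :
    ∃ w', letterNumbers eS w' = w := by
  replace hw := (mem_wordsUpTo.1 hw).2
  induction w with
  | nil => exact ⟨[], rfl⟩
  | cons a w ih =>
    obtain ⟨ha, hw⟩ := List.forall_mem_cons.1 hw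
    obtain ⟨w', rfl⟩ := ih hw
    exact ⟨eS.symm ⟨a, ha⟩ :: w', by simp [letterNumbers]⟩

theorem recurrent_iff (hc : c.EncodesVia M eK eS) (u : List S) :
    c.Recurrent (letterNumbers eS u) ↔ M.Recurrent u := by
  constructor
  · intro h w
    obtain ⟨w', hw', hw⟩ := exists_mem_words eK eS M w
    obtain ⟨y, hy, hsame⟩ := h _ hw'
    obtain ⟨y, rfl⟩ := exists_letterNumbers_eq eS hy
    rw [← letterNumbers_append, ← letterNumbers_append, sameProfile_iff hc] at hsame
    refine ⟨y, Eq.trans ?_ hsame⟩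
    exact FSM.profile_append_congr (FSM.profile_append_congr rfl hw.symm) rfl
  · intro h w hw
    obtain ⟨w, rfl⟩ := exists_letterNumbers_eq eS hw
    obtain ⟨y, hy⟩ := h w
    obtain ⟨y', hy', hyy'⟩ := exists_mem_words eK eS M y
    refine ⟨_, hy', ?_⟩
    rw [← letterNumbers_append, ← letterNumbers_append, sameProfile_iff hc, ← hy]
    exact FSM.profile_append_congr rfl hyy'

theorem reachable_iff (hc : c.EncodesVia M eK eS) (p : K) :
    c.Reachable (eK p) ↔ ∃ v Y, (M.q₀, Y, p) ∈ M.profile v := by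
  constructor
  · rintro ⟨v, hv, s, hs, h1, h2⟩
    obtain ⟨v, rfl⟩ := exists_letterNumbers_eq eS hv
    obtain ⟨p', q', h3, h4, h⟩ := mem_fsmProfile_of_mem_profile hc v hs
    obtain rfl : p' = M.q₀ := eK.injective (Fin.ext ((h3.symm.trans h1).trans hc.1.symm))
    obtain rfl : q' = p := eK.injective (Fin.ext (h4.symm.trans h2))
    exact ⟨v, _, h⟩
  · rintro ⟨v, Y, h⟩
    obtain ⟨v', hv', hvv'⟩ := exists_mem_words eK eS M v
    obtain ⟨l, hl, -⟩ := exists_mem_profile_of_mem_fsmProfile hc v' (hvv' ▸ h)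
    exact ⟨_, hv', _, hl, hc.1, rfl⟩

theorem hasRecurrentLoop_iff (hc : c.EncodesVia M eK eS) {acc : List ℕ → Prop}
    {𝓕 : Set (Set K)} (hacc : ∀ l, acc l ↔ {x | (eK x : ℕ) ∈ l} ∈ 𝓕) :
    c.HasRecurrentLoop acc ↔ M.HasRecurrentLoop 𝓕 := by
  constructor
  · rintro ⟨u, hu, hrec, ⟨p', l, q'⟩, ht, h1, h2, h3, h4⟩
    obtain ⟨u, rfl⟩ := exists_letterNumbers_eq eS hu
    obtain ⟨p, q, rfl, rfl, h⟩ := mem_fsmProfile_of_mem_profile hc u ht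
    obtain rfl : q = p := eK.injective (Fin.ext h1)
    exact ⟨u, (recurrent_iff hc u).1 hrec, q, _, h, h2, (hacc l).1 h3, (reachable_iff hc q).1 h4⟩
  · rintro ⟨u, hrec, p, X, hX, hp, hXF, hreach⟩
    obtain ⟨u', hu', huu'⟩ := exists_mem_words eK eS M u
    have hrec' : M.Recurrent u' := fun w => by
      obtain ⟨y, hy⟩ := hrec w
      refine ⟨y, Eq.trans ?_ (hy.trans huu'.symm)⟩
      exact FSM.profile_append_congr (FSM.profile_append_congr huu' rfl) rfl
    obtain ⟨l, hl, rfl⟩ := exists_mem_profile_of_mem_fsmProfile hc u' (huu' ▸ hX)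
    exact ⟨_, hu', (recurrent_iff hc u').2 hrec', _, hl, rfl, hp, (hacc l).2 hXF,
      (reachable_iff hc p).2 hreach⟩

end Correctness

end FSMCode

/-! ### Computability of the decision procedure -/

section Primrec

open Primrec

variable {α β : Type*} [Primcodable α] [Primcodable β]

theorem PrimrecPred.exists_mem {R : α → β → Prop} (hR : PrimrecPred fun x : α × β => R x.1 x.2)
    {f : α → List β} (hf : Primrec f) : PrimrecPred fun a => ∃ b ∈ f a, R a b :=
  (PrimrecRel.exists_mem_list (R := fun b a => R a b) hR.primrecRel.swap).comp hf .id

theorem PrimrecPred.forall_mem {R : α → β → Prop} (hR : PrimrecPred fun x : α × β => R x.1 x.2)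
    {f : α → List β} (hf : Primrec f) : PrimrecPred fun a => ∀ b ∈ f a, R a b :=
  (PrimrecRel.forall_mem_list (R := fun b a => R a b) hR.primrecRel.swap).comp hf .id

theorem PrimrecPred.forall_lt_of {R : α → ℕ → Prop} (hR : PrimrecPred fun x : α × ℕ => R x.1 x.2)
    {f : α → ℕ} (hf : Primrec f) : PrimrecPred fun a => ∀ b < f a, R a b :=
  (hR.forall_mem (list_range.comp hf)).of_eq fun a => by simp

theorem PrimrecPred.iff {p q : α → Prop} (hp : PrimrecPred p) (hq : PrimrecPred q) :
    PrimrecPred fun a => p a ↔ q a :=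
  ((hp.and hq).or (hp.not.and hq.not)).of_eq fun _ => iff_iff_and_or_not_and_not.symm

theorem PrimrecPred.mem_list {f : α → β} {g : α → List β} (hf : Primrec f) (hg : Primrec g) :
    PrimrecPred fun a => f a ∈ g a :=
  (PrimrecPred.exists_mem (R := fun a b => b = f a) (Primrec.eq.comp snd (hf.comp fst)) hg).of_eq
    fun a => by simp

theorem PrimrecPred.sameBelow {n : α → ℕ} {f g : α → List ℕ} (hn : Primrec n) (hf : Primrec f)
    (hg : Primrec g) : PrimrecPred fun a => SameBelow (n a) (f a) (g a) :=
  PrimrecPred.forall_lt_of (R := fun a x => x ∈ f a ↔ x ∈ g a)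
    ((PrimrecPred.mem_list snd (hf.comp fst)).iff (PrimrecPred.mem_list snd (hg.comp fst))) hn

theorem primrec_pow : Primrec₂ ((· ^ ·) : ℕ → ℕ → ℕ) :=
  Primrec₂.unpaired'.1 Nat.Primrec.pow

theorem primrec_wordsUpTo : Primrec₂ wordsUpTo := by
  have h1 : Primrec₂ fun (x : (ℕ × ℕ × List (List ℕ)) × List ℕ) (a : ℕ) => a :: x.2 :=
    list_cons.comp snd (snd.comp fst)
  have h2 : Primrec₂ fun (x : ℕ × ℕ × List (List ℕ)) (w : List ℕ) =>
      (List.range x.1).map fun a => a :: w :=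
    list_map (list_range.comp (fst.comp fst)) h1
  have h3 : Primrec₂ fun (m : ℕ) (x : ℕ × List (List ℕ)) =>
      [] :: x.2.flatMap fun w => (List.range m).map fun a => a :: w :=
    list_cons.comp (.const []) (list_flatMap (snd.comp snd) h2)
  exact Primrec.nat_rec (f := fun _ : ℕ => [([] : List ℕ)]) (.const _) h3

namespace FSMCode

theorem primrec_numStates : Primrec FSMCode.numStates :=
  (fst.comp (Primrec.of_equiv (e := equivProd))).of_eq fun _ => rfl

theorem primrec_numLetters : Primrec FSMCode.numLetters :=
  (fst.comp snd).comp (Primrec.of_equiv (e := equivProd))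

theorem primrec_transitions : Primrec FSMCode.transitions :=
  (fst.comp (snd.comp snd)).comp (Primrec.of_equiv (e := equivProd))

theorem primrec_initial : Primrec FSMCode.initial :=
  (snd.comp (snd.comp snd)).comp (Primrec.of_equiv (e := equivProd))

theorem primrec_words : Primrec FSMCode.words := by
  refine primrec_wordsUpTo.comp primrec_numLetters (primrec_pow.comp (.const 2) ?_)
  exact nat_mul.comp primrec_numStates
    (nat_mul.comp (primrec_pow.comp (.const 2) primrec_numStates) primrec_numStates)

theorem primrec_profileStep :
    Primrec fun x : FSMCode × List (ℕ × List ℕ × ℕ) × ℕ => x.1.profileStep x.2.1 x.2.2 := by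
  -- The context consists of the code, the triples and the letter, a triple, and a transition.
  have hc : Primrec fun x : ((FSMCode × List (ℕ × List ℕ × ℕ) × ℕ) × (ℕ × List ℕ × ℕ)) ×
      (ℕ × ℕ × ℕ) => x.1.1.1.numStates := primrec_numStates.comp (fst.comp (fst.comp fst))
  have ha : Primrec fun x : ((FSMCode × List (ℕ × List ℕ × ℕ) × ℕ) × (ℕ × List ℕ × ℕ)) ×
      (ℕ × ℕ × ℕ) => x.1.1.2.2 := snd.comp (snd.comp (fst.comp fst))
  have hs : Primrec fun x : ((FSMCode × List (ℕ × List ℕ × ℕ) × ℕ) × (ℕ × List ℕ × ℕ)) ×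
      (ℕ × ℕ × ℕ) => x.1.2 := snd.comp fst
  have he : Primrec fun x : ((FSMCode × List (ℕ × List ℕ × ℕ) × ℕ) × (ℕ × List ℕ × ℕ)) ×
      (ℕ × ℕ × ℕ) => x.2 := snd
  have hq := snd.comp (snd.comp he)
  have h1 := Primrec.eq.comp (fst.comp he) (snd.comp (snd.comp hs))
  have h2 := Primrec.eq.comp (fst.comp (snd.comp he)) ha
  have h3 := nat_lt.comp hq hc
  have h4 := list_cons.comp (Primrec.pair (fst.comp hs)
      (Primrec.pair (list_cons.comp hq (fst.comp (snd.comp hs))) hq)) (.const [])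
  have h5 : Primrec₂ fun (x : (FSMCode × List (ℕ × List ℕ × ℕ) × ℕ) × (ℕ × List ℕ × ℕ))
      (e : ℕ × ℕ × ℕ) => if e.1 = x.2.2.2 ∧ e.2.1 = x.1.2.2 ∧ e.2.2 < x.1.1.numStates
        then [(x.2.1, e.2.2 :: x.2.2.1, e.2.2)] else [] :=
    Primrec.ite (h1.and (h2.and h3)) h4 (.const [])
  have h6 : Primrec₂ fun (x : FSMCode × List (ℕ × List ℕ × ℕ) × ℕ) (s : ℕ × List ℕ × ℕ) =>
      x.1.transitions.flatMap fun e => if e.1 = s.2.2 ∧ e.2.1 = x.2.2 ∧ e.2.2 < x.1.numStates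
        then [(s.1, e.2.2 :: s.2.1, e.2.2)] else [] :=
    list_flatMap (primrec_transitions.comp (fst.comp fst)) h5
  exact list_flatMap (fst.comp snd) h6

theorem primrec_profile : Primrec₂ FSMCode.profile := by
  have h1 : Primrec₂ fun (_ : FSMCode × List ℕ) (p : ℕ) => (p, ([] : List ℕ), p) :=
    Primrec.pair snd (Primrec.pair (.const []) snd)
  have h2 : Primrec fun x : FSMCode × List ℕ =>
      (List.range x.1.numStates).map fun p => (p, ([] : List ℕ), p) :=
    list_map (list_range.comp (primrec_numStates.comp fst)) h1
  have h3 : Primrec fun x : (FSMCode × List ℕ) × (List (ℕ × List ℕ × ℕ) × ℕ) => (x.1.1, x.2) :=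
    Primrec.pair (fst.comp fst) snd
  have h4 : Primrec₂ fun (x : FSMCode × List ℕ) (y : List (ℕ × List ℕ × ℕ) × ℕ) =>
      x.1.profileStep y.1 y.2 := (primrec_profileStep.comp h3).to₂
  -- Naming the term first lets the two functions in it be found without reference to the goal.
  have h5 := list_foldl (f := fun x : FSMCode × List ℕ => x.2) snd h2 h4
  exact h5

theorem primrecPred_hasTriple {c : α → FSMCode} {t : α → ℕ × List ℕ × ℕ}
    {T : α → List (ℕ × List ℕ × ℕ)} (hc : Primrec c) (ht : Primrec t) (hT : Primrec T) :
    PrimrecPred fun a => (c a).HasTriple (t a) (T a) := by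
  refine PrimrecPred.exists_mem (R := fun a t' => t'.1 = (t a).1 ∧ t'.2.2 = (t a).2.2 ∧
    SameBelow (c a).numStates t'.2.1 (t a).2.1) ?_ hT
  have hn : Primrec fun x : α × (ℕ × List ℕ × ℕ) => (c x.1).numStates :=
    primrec_numStates.comp (hc.comp fst)
  have ht' : Primrec fun x : α × (ℕ × List ℕ × ℕ) => t x.1 := ht.comp fst
  have hs : Primrec fun x : α × (ℕ × List ℕ × ℕ) => x.2 := snd
  have h1 := Primrec.eq.comp (fst.comp hs) (fst.comp ht')
  have h2 := Primrec.eq.comp (snd.comp (snd.comp hs)) (snd.comp (snd.comp ht'))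
  have h3 := PrimrecPred.sameBelow hn (fst.comp (snd.comp hs)) (fst.comp (snd.comp ht'))
  exact h1.and (h2.and h3)

theorem primrecPred_sameProfile {c : α → FSMCode} {T T' : α → List (ℕ × List ℕ × ℕ)}
    (hc : Primrec c) (hT : Primrec T) (hT' : Primrec T') :
    PrimrecPred fun a => (c a).SameProfile (T a) (T' a) :=
  (PrimrecPred.forall_mem (R := fun a t => (c a).HasTriple t (T' a))
    (primrecPred_hasTriple (hc.comp fst) snd (hT'.comp fst)) hT).and
  (PrimrecPred.forall_mem (R := fun a t => (c a).HasTriple t (T a))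
    (primrecPred_hasTriple (hc.comp fst) snd (hT.comp fst)) hT')

theorem primrecPred_recurrent {c : α → FSMCode} {u : α → List ℕ} (hc : Primrec c)
    (hu : Primrec u) : PrimrecPred fun a => (c a).Recurrent (u a) := by
  refine PrimrecPred.forall_mem (R := fun a w => ∃ y ∈ (c a).words,
    (c a).SameProfile ((c a).profile (u a ++ w ++ y)) ((c a).profile (u a))) ?_
    (primrec_words.comp hc)
  refine PrimrecPred.exists_mem (R := fun (a : α × List ℕ) y =>
    (c a.1).SameProfile ((c a.1).profile (u a.1 ++ a.2 ++ y)) ((c a.1).profile (u a.1))) ?_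
    (primrec_words.comp (hc.comp fst))
  have hc' := hc.comp (fst.comp (fst (α := α × List ℕ) (β := List ℕ)))
  have hu' := hu.comp (fst.comp (fst (α := α × List ℕ) (β := List ℕ)))
  exact primrecPred_sameProfile hc' (primrec_profile.comp hc'
    (list_append.comp (list_append.comp hu' (snd.comp fst)) snd)) (primrec_profile.comp hc' hu')

theorem primrecPred_reachable {c : α → FSMCode} {p : α → ℕ} (hc : Primrec c) (hp : Primrec p) :
    PrimrecPred fun a => (c a).Reachable (p a) := by
  refine PrimrecPred.exists_mem (R := fun a v => ∃ s ∈ (c a).profile v,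
    s.1 = (c a).initial ∧ s.2.2 = p a) ?_ (primrec_words.comp hc)
  refine PrimrecPred.exists_mem (R := fun (a : α × List ℕ) (s : ℕ × List ℕ × ℕ) =>
    s.1 = (c a.1).initial ∧ s.2.2 = p a.1) ?_ (primrec_profile.comp (hc.comp fst) snd)
  exact (Primrec.eq.comp (fst.comp snd) (primrec_initial.comp (hc.comp (fst.comp fst)))).and
    (Primrec.eq.comp (snd.comp (snd.comp snd)) (hp.comp (fst.comp fst)))

theorem primrecPred_hasRecurrentLoop {c : α → FSMCode} {acc : α → List ℕ → Prop} (hc : Primrec c)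
    (hacc : PrimrecPred fun x : α × List ℕ => acc x.1 x.2) :
    PrimrecPred fun a => (c a).HasRecurrentLoop (acc a) := by
  refine PrimrecPred.exists_mem (R := fun a u => (c a).Recurrent u ∧ ∃ t ∈ (c a).profile u,
    t.2.2 = t.1 ∧ t.1 ∈ t.2.1 ∧ acc a t.2.1 ∧ (c a).Reachable t.1) ?_ (primrec_words.comp hc)
  refine (primrecPred_recurrent (hc.comp fst) snd).and ?_
  refine PrimrecPred.exists_mem (R := fun (a : α × List ℕ) (t : ℕ × List ℕ × ℕ) =>
    t.2.2 = t.1 ∧ t.1 ∈ t.2.1 ∧ acc a.1 t.2.1 ∧ (c a.1).Reachable t.1) ?_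
    (primrec_profile.comp (hc.comp fst) snd)
  have hX : Primrec fun x : (α × List ℕ) × (ℕ × List ℕ × ℕ) => x.2.2.1 := fst.comp (snd.comp snd)
  have hp : Primrec fun x : (α × List ℕ) × (ℕ × List ℕ × ℕ) => x.2.1 := fst.comp snd
  exact (Primrec.eq.comp (snd.comp (snd.comp snd)) hp).and ((PrimrecPred.mem_list hp hX).and
    ((hacc.comp (Primrec.pair (fst.comp fst) hX)).and
      (primrecPred_reachable (hc.comp (fst.comp fst)) hp)))

end FSMCode

/-- The set of states that is represented by `l` contains a final state. -/
def BuchiCode.Accepts (c : BuchiCode) (l : List ℕ) : Prop :=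
  ∃ x ∈ l, x < c.machine.numStates ∧ x ∈ c.final

/-- The list `l` represents one of the designated sets. -/
def MullerCode.Accepts (c : MullerCode) (l : List ℕ) : Prop :=
  ∃ d ∈ c.designated, SameBelow c.machine.numStates l d

theorem BuchiCode.primrec_machine : Primrec BuchiCode.machine :=
  (fst.comp (Primrec.of_equiv (e := equivProd))).of_eq fun _ => rfl

theorem BuchiCode.primrec_final : Primrec BuchiCode.final :=
  (snd.comp (Primrec.of_equiv (e := equivProd))).of_eq fun _ => rfl

theorem MullerCode.primrec_machine : Primrec MullerCode.machine :=
  (fst.comp (Primrec.of_equiv (e := equivProd))).of_eq fun _ => rfl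

theorem MullerCode.primrec_designated : Primrec MullerCode.designated :=
  (snd.comp (Primrec.of_equiv (e := equivProd))).of_eq fun _ => rfl

theorem BuchiCode.primrecPred_accepts :
    PrimrecPred fun x : BuchiCode × List ℕ => x.1.Accepts x.2 := by
  refine PrimrecPred.exists_mem (R := fun (a : BuchiCode × List ℕ) x =>
    x < a.1.machine.numStates ∧ x ∈ a.1.final) ?_ snd
  have hc : Primrec fun x : (BuchiCode × List ℕ) × ℕ => x.1.1 := fst.comp fst
  exact (nat_lt.comp snd (FSMCode.primrec_numStates.comp (primrec_machine.comp hc))).and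
    (PrimrecPred.mem_list snd (primrec_final.comp hc))

theorem MullerCode.primrecPred_accepts :
    PrimrecPred fun x : MullerCode × List ℕ => x.1.Accepts x.2 := by
  refine PrimrecPred.exists_mem (R := fun (a : MullerCode × List ℕ) d =>
    SameBelow a.1.machine.numStates a.2 d) ?_ (primrec_designated.comp fst)
  exact PrimrecPred.sameBelow
    (FSMCode.primrec_numStates.comp (primrec_machine.comp (fst.comp fst))) (snd.comp fst) snd

end Primrec

theorem PrimrecPred.exists_computable_not {α : Type*} [Primcodable α] {p : α → Prop}
    (hp : PrimrecPred p) : ∃ f : α → Bool, Computable f ∧ ∀ a, f a = true ↔ ¬ p a := by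
  obtain ⟨_, h⟩ := hp.not
  exact ⟨_, h.to_comp, fun a => decide_eq_true_iff⟩

theorem BuchiCode.isMeagre_language_iff {K S : Type*} [Finite K] [Finite S] [TopologicalSpace S]
    [DiscreteTopology S] {A : BuchiAutomaton K S} {c : BuchiCode} (h : c.Encodes A) :
    IsMeagre A.language ↔ ¬ c.machine.HasRecurrentLoop c.Accepts := by
  obtain ⟨eK, eS, hM, hF⟩ := h
  rw [FSMCode.hasRecurrentLoop_iff hM (𝓕 := {X | (X ∩ A.F).Nonempty}) fun l => ?_,
    ← FSM.isMeagre_iff]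
  · rfl
  constructor
  · rintro ⟨x, hx, hlt, hxF⟩
    exact ⟨eK.symm ⟨x, hlt⟩, by simpa using hx, (hF _).2 (by simpa using hxF)⟩
  · rintro ⟨x, hx, hxF⟩
    exact ⟨eK x, hx, (eK x).isLt, (hF x).1 hxF⟩

theorem MullerCode.isMeagre_language_iff {K S : Type*} [Finite K] [Finite S] [TopologicalSpace S]
    [DiscreteTopology S] {A : MullerAutomaton K S} {c : MullerCode} (h : c.Encodes A) :
    IsMeagre A.language ↔ ¬ c.machine.HasRecurrentLoop c.Accepts := by
  obtain ⟨eK, eS, hM, hF⟩ := h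
  rw [FSMCode.hasRecurrentLoop_iff hM (𝓕 := A.𝓕) fun l => ?_, ← FSM.isMeagre_iff]
  · rfl
  rw [hF]
  refine exists_congr fun d => and_congr_right fun _ => ?_
  rw [FSMCode.sameBelow_iff eK, Set.ext_iff]
  rfl

theorem mainTheorem2 :
    (∃ f : BuchiCode → Bool, Computable f ∧
      ∀ (K : Type) (S : Type) [Finite K] [Finite S] [TopologicalSpace S] [DiscreteTopology S]
        (A : BuchiAutomaton K S) (c : BuchiCode), c.Encodes A →
          (f c = true ↔ IsMeagre A.language)) ∧
    (∃ f : MullerCode → Bool, Computable f ∧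
      ∀ (K : Type) (S : Type) [Finite K] [Finite S] [TopologicalSpace S] [DiscreteTopology S]
        (A : MullerAutomaton K S) (c : MullerCode), c.Encodes A →
          (f c = true ↔ IsMeagre A.language)) := by
  obtain ⟨f, hf, hfp⟩ := (FSMCode.primrecPred_hasRecurrentLoop BuchiCode.primrec_machine
    BuchiCode.primrecPred_accepts).exists_computable_not
  obtain ⟨g, hg, hgp⟩ := (FSMCode.primrecPred_hasRecurrentLoop MullerCode.primrec_machine
    MullerCode.primrecPred_accepts).exists_computable_not
  exact ⟨⟨f, hf, fun K S _ _ _ _ A c hc => (hfp c).trans (BuchiCode.isMeagre_language_iff hc).symm⟩,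
    ⟨g, hg, fun K S _ _ _ _ A c hc => (hgp c).trans (MullerCode.isMeagre_language_iff hc).symm⟩⟩
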